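/- Let $\alpha$ be a countable ordinal with $\alpha\ge 1$, and for every limit ordinal $\delta\le\alpha$ fix a strictly increasing sequence $(\delta_k)_{k\in\mathbb N}$ of ordinals that is cofinal in $\delta$. Let $T_\alpha\subset\mathbb N^{<\omega}$ be the well-founded tree with rank function $\mathrm{rk}$ determined as follows: the root $\langle\rangle$ is in $T_\alpha$ and has rank $\alpha$; if $\sigma\in T_\alpha$ has rank $\beta+1$, then for all $k\in\mathbb N$, $\sigma\hat{\ }k\in T_\alpha$ and has rank $\beta$; if $\sigma\in T_\alpha$ has limit rank $\delta$, then for all $k\in\mathbb N$, $\sigma\hat{\ }k\in T_\alpha$ and has rank $\delta_k$; nodes of rank $0$ have no children. Let $\mathscr L_\alpha$ be the set of leaves of $T_\alpha$ (the nodes of rank $0$), and give $2^{\mathscr L_\alpha}=\{0,1\}^{\mathscr L_\alpha}$ the product topology. For $x\in 2^{\mathscr L_\alpha}$ let $F^x,I^x\colon T_\alpha\to\{0,1\}$ be the labellings defined by recursion as follows: $F^x(\sigma)=I^x(\sigma)=x(\sigma)$ for $\sigma\in\mathscr L_\alpha$, and for $\sigma\in T_\alpha\setminus\mathscr L_\alpha$,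 $$F^x(\sigma)=1\iff\{k\in\mathbb N: F^x(\sigma\hat{\ }k)=1\}\text{ is cofinite},$$ $$I^x(\sigma)=0\iff\{k\in\mathbb N: I^x(\sigma\hat{\ }k)=0\}\text{ is cofinite}.$$ The $\alpha$-th iterate of the Fréchet filter is $\mathcal F_\alpha=\{x\in 2^{\mathscr L_\alpha}:F^x(\langle\rangle)=1\}$, and the $\alpha$-th iterate of the Fréchet ideal is $\mathcal I_\alpha=\{x\in 2^{\mathscr L_\alpha}:I^x(\langle\rangle)=0\}$. **Theorem.** $\mathcal F_\alpha$ and $\mathcal I_\alpha$ cannot be separated by a $\mathbf\Delta^0_{\alpha+1}$ set: there is no set $Z\subseteq 2^{\mathscr L_\alpha}$ such that both $Z$ and its complement are $\mathbf\Sigma^0_{\alpha+1}$, $\mathcal F_\alpha\subseteq Z$ and $\mathcal I_\alpha\cap Z=\emptyset$. Here $\mathbf\Sigma^0_1$ is the class of open sets, and for $\beta>1$ a set is $\mathbf\Sigma^0_\beta$ if it is a union of countably many sets, each of which is the complement of a $\mathbf\Sigma^0_\gamma$ set for some $1\le\gamma<\beta$. -/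

import Mathlib

open scoped Ordinal

namespace IteratedFrechet

/-- A choice, for every limit ordinal `δ ≤ α`, of an increasing cofinal sequence
`(δ_k)` of ordinals below `δ` (the values of `seq` elsewhere are irrelevant). -/
structure CofinalSequences (α : Ordinal.{0}) where
  seq : Ordinal.{0} → ℕ → Ordinal.{0}
  strictMono : ∀ δ, δ ≤ α → Order.IsSuccLimit δ → StrictMono (seq δ)
  lt : ∀ δ, δ ≤ α → Order.IsSuccLimit δ → ∀ k, seq δ k < δ
  cofinal : ∀ δ, δ ≤ α → Order.IsSuccLimit δ → ∀ β, β < δ → ∃ k, β ≤ seq δ k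

namespace CofinalSequences

variable {α : Ordinal.{0}} (c : CofinalSequences α)

/-- `c.HasRank σ β`: the finite sequence `σ` is a node of the tree `T_α`, and its rank is `β`.
The root has rank `α`; a node of rank `β + 1` has the children `σ⌢k`, all of rank `β`; a node of
limit rank `δ` has the children `σ⌢k`, of rank `δ_k`; nodes of rank `0` have no children. -/
inductive HasRank : List ℕ → Ordinal.{0} → Prop
  | root : HasRank [] α
  | succ (σ : List ℕ) (β : Ordinal.{0}) (k : ℕ) :
      HasRank σ (Order.succ β) → HasRank (σ ++ [k]) β
  | limit (σ : List ℕ) (δ : Ordinal.{0}) (k : ℕ) :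
      Order.IsSuccLimit δ → HasRank σ δ → HasRank (σ ++ [k]) (c.seq δ k)

/-- The tree `T_α`. -/
def tree : Set (List ℕ) := {σ | ∃ β, c.HasRank σ β}

/-- The set `𝓛_α` of leaves of `T_α`. -/
def leaves : Set (List ℕ) := {σ | c.HasRank σ 0}

/-- The space `2^{𝓛_α}`; its topology is the product topology. -/
abbrev Space : Type := c.leaves → Bool

theorem HasRank.le {c : CofinalSequences α} {σ : List ℕ} {β : Ordinal.{0}}
    (h : c.HasRank σ β) : β ≤ α := by
  induction h with
  | root => exact le_rfl
  | succ σ β k _ ih => exact (Order.le_succ β).trans ih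
  | limit σ δ k hδ _ ih => exact (c.lt δ ih hδ k).le.trans ih

theorem HasRank.unique {c : CofinalSequences α} {σ : List ℕ} {β γ : Ordinal.{0}}
    (h : c.HasRank σ β) (h' : c.HasRank σ γ) : β = γ := by
  induction h generalizing γ with
  | root =>
    generalize hτ : ([] : List ℕ) = τ at h'
    cases h' with
    | root => rfl
    | succ => simp at hτ
    | limit => simp at hτ
  | succ σ β k h ih =>
    generalize hτ : σ ++ [k] = τ at h'
    cases h' with
    | root => simp at hτ
    | succ σ' _ k' h2 =>
      obtain ⟨rfl, hk⟩ := List.append_inj' hτ rfl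
      exact Order.succ_injective (ih h2)
    | limit σ' δ k' hδ h2 =>
      obtain ⟨rfl, hk⟩ := List.append_inj' hτ rfl
      exact absurd hδ (ih h2 ▸ Order.not_isSuccLimit_succ β)
  | limit σ δ k hδ h ih =>
    generalize hτ : σ ++ [k] = τ at h'
    cases h' with
    | root => simp at hτ
    | succ σ' _ k' h2 =>
      obtain ⟨rfl, hk⟩ := List.append_inj' hτ rfl
      exact absurd (ih h2 ▸ hδ) (Order.not_isSuccLimit_succ γ)
    | limit σ' δ' k' hδ' h2 =>
      obtain ⟨rfl, hk⟩ := List.append_inj' hτ rfl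
      obtain rfl := ih h2
      simp only [List.cons.injEq, and_true] at hk
      rw [hk]

theorem HasRank.child_lt {c : CofinalSequences α} {σ : List ℕ} {k : ℕ} {β γ : Ordinal.{0}}
    (h : c.HasRank σ β) (h' : c.HasRank (σ ++ [k]) γ) : γ < β := by
  generalize hτ : σ ++ [k] = τ at h'
  cases h' with
  | root => simp at hτ
  | succ σ' _ k' h2 =>
    obtain ⟨rfl, hk⟩ := List.append_inj' hτ rfl
    rw [h.unique h2]
    exact Order.lt_succ γ
  | limit σ' δ k' hδ h2 =>
    obtain ⟨rfl, hk⟩ := List.append_inj' hτ rfl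
    rw [h.unique h2]
    exact c.lt δ h2.le hδ k'

/-- A node which is not a leaf has all its children in the tree. -/
theorem child_mem_tree {σ : List ℕ} (hσ : σ ∈ c.tree) (hl : σ ∉ c.leaves) (k : ℕ) :
    σ ++ [k] ∈ c.tree := by
  obtain ⟨β, hβ⟩ := hσ
  rcases Ordinal.zero_or_succ_or_isSuccLimit β with rfl | ⟨γ, rfl⟩ | hlim
  · exact absurd hβ hl
  · exact ⟨γ, HasRank.succ σ γ k hβ⟩
  · exact ⟨_, HasRank.limit σ β k hlim hβ⟩

/-- `τ` is a child of `σ` in the tree. -/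
def Child (τ σ : c.tree) : Prop := ∃ k : ℕ, τ.1 = σ.1 ++ [k]

theorem child_wellFounded : WellFounded c.Child := by
  refine Subrelation.wf (r := InvImage (· < ·) (fun σ : c.tree => Classical.choose σ.2)) ?_
    (InvImage.wf _ wellFounded_lt)
  rintro ⟨τ, hτ⟩ ⟨σ, hσ⟩ ⟨k, hk⟩
  simp only at hk
  subst hk
  exact (Classical.choose_spec hσ).child_lt (Classical.choose_spec hτ)

/-- The root `⟨⟩` of the tree. -/
def root : c.tree := ⟨[], α, HasRank.root⟩

/-- The child `σ⌢k` of a node which is not a leaf. -/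
def child (σ : c.tree) (hl : σ.1 ∉ c.leaves) (k : ℕ) : c.tree :=
  ⟨σ.1 ++ [k], c.child_mem_tree σ.2 hl k⟩

open Classical in
/-- The filter labelling `F^x` of the tree (with `true` for `1`): it agrees with `x` on the leaves,
and `F^x(σ) = 1` iff `{k | F^x(σ⌢k) = 1}` is cofinite when `σ` is not a leaf. -/
noncomputable def filterLabel (x : c.Space) : c.tree → Bool :=
  c.child_wellFounded.fix fun σ label =>
    if hl : σ.1 ∈ c.leaves then x ⟨σ.1, hl⟩
    else decide ({k : ℕ | label (c.child σ hl k) ⟨k, rfl⟩ = true}ᶜ.Finite)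

open Classical in
/-- The ideal labelling `I^x` of the tree (with `false` for `0`): it agrees with `x` on the leaves,
and `I^x(σ) = 0` iff `{k | I^x(σ⌢k) = 0}` is cofinite when `σ` is not a leaf. -/
noncomputable def idealLabel (x : c.Space) : c.tree → Bool :=
  c.child_wellFounded.fix fun σ label =>
    if hl : σ.1 ∈ c.leaves then x ⟨σ.1, hl⟩
    else !decide ({k : ℕ | label (c.child σ hl k) ⟨k, rfl⟩ = false}ᶜ.Finite)

theorem filterLabel_leaf (x : c.Space) (σ : c.tree) (hl : σ.1 ∈ c.leaves) :
    c.filterLabel x σ = x ⟨σ.1, hl⟩ := by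
  rw [filterLabel, WellFounded.fix_eq, dif_pos hl]

theorem filterLabel_node (x : c.Space) (σ : c.tree) (hl : σ.1 ∉ c.leaves) :
    c.filterLabel x σ = true ↔ {k : ℕ | c.filterLabel x (c.child σ hl k) = true}ᶜ.Finite := by
  classical
  conv_lhs => rw [filterLabel, WellFounded.fix_eq, dif_neg hl]
  exact decide_eq_true_iff

theorem idealLabel_leaf (x : c.Space) (σ : c.tree) (hl : σ.1 ∈ c.leaves) :
    c.idealLabel x σ = x ⟨σ.1, hl⟩ := by
  rw [idealLabel, WellFounded.fix_eq, dif_pos hl]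

theorem idealLabel_node (x : c.Space) (σ : c.tree) (hl : σ.1 ∉ c.leaves) :
    c.idealLabel x σ = false ↔ {k : ℕ | c.idealLabel x (c.child σ hl k) = false}ᶜ.Finite := by
  classical
  conv_lhs => rw [idealLabel, WellFounded.fix_eq, dif_neg hl, Bool.not_eq_false']
  exact decide_eq_true_iff

/-- The `α`-th iterate of the Fréchet filter, a subset of `2^{𝓛_α}`. -/
def frechetFilter : Set c.Space := {x | c.filterLabel x c.root = true}

/-- The `α`-th iterate of the Fréchet ideal, a subset of `2^{𝓛_α}`. -/
def frechetIdeal : Set c.Space := {x | c.idealLabel x c.root = false}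

end CofinalSequences

/-- The boldface Borel classes `Σ⁰_β` for `β ≥ 1`: `Σ⁰_1` consists of the open sets, and for
`β > 1` a set is `Σ⁰_β` iff it is a union of countably many sets whose complements are `Σ⁰_γ`
for some (varying) `1 ≤ γ < β`. -/
inductive BoldSigma {X : Type*} [TopologicalSpace X] : Ordinal.{0} → Set X → Prop
  | of_isOpen (U : Set X) : IsOpen U → BoldSigma 1 U
  | iUnion (β : Ordinal.{0}) (A : ℕ → Set X) (γ : ℕ → Ordinal.{0}) :
      (∀ n, 1 ≤ γ n ∧ γ n < β) → (∀ n, BoldSigma (γ n) (A n)ᶜ) → BoldSigma β (⋃ n, A n)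

/-- The boldface class `Δ⁰_β`: both the set and its complement are `Σ⁰_β`. -/
def BoldDelta {X : Type*} [TopologicalSpace X] (β : Ordinal.{0}) (A : Set X) : Prop :=
  BoldSigma β A ∧ BoldSigma β Aᶜ

/-- `Z` separates `A` from `B`. -/
def Separates {X : Type*} (Z A B : Set X) : Prop := A ⊆ Z ∧ B ⊆ Zᶜ

end IteratedFrechet

open Filter

namespace IteratedFrechet

/-! ### Closure properties of the Borel classes. -/

section BoldSigma

variable {X : Type*} [TopologicalSpace X]

/-! The proof is a diagonalization. Let `Z` be a `Δ⁰_{α+1}` separator and put its complement at the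
root. By `exists_limit_of_boldDelta`, a `Δ⁰_{β+1}` set at a node of rank `β ≠ 0` is a pointwise
limit of simpler sets, which go to the children. Repeating this down the tree (`exists_nodeSets`)
gives each leaf a set depending only on leaves of smaller code. Hence some point `x` satisfies `x l
= 1` iff `x` lies in the set at `l`, for all leaves `l` (`exists_fixedPoint`).

Limits climb back up the tree (`labels_of_nodeSets`): if `x` is in the root set then `x` is in the
filter, otherwise in the ideal. As the root set is `Zᶜ`, `x ∉ Z` puts `x` in the filter and `x ∈ Z`
puts it in the ideal, so `Z` separates nothing.

At rank 0, clopen sets would not suffice: the fixed point needs an explicit bound on the coordinates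
used, hence the special case in `levelAlgebra`. -/

theorem BoldSigma.one_le {β : Ordinal.{0}} {A : Set X} (h : BoldSigma β A) : 1 ≤ β := by
  cases h with
  | of_isOpen => exact le_rfl
  | iUnion _ A γ h => exact (h 0).1.trans (h 0).2.le

/-- A set of class `Σ⁰_γ` is the complement of a set of class `Σ⁰_β` for `γ < β`. -/
theorem BoldSigma.compl_of_lt {β γ : Ordinal.{0}} {A : Set X} (h : BoldSigma γ A) (hγ : γ < β) :
    BoldSigma β Aᶜ := by
  have := BoldSigma.iUnion β (fun _ : ℕ => Aᶜ) (fun _ => γ) (fun _ => ⟨h.one_le, hγ⟩)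
    (fun _ => by rwa [compl_compl])
  rwa [Set.iUnion_const] at this

theorem BoldSigma.union {β : Ordinal.{0}} {A B : Set X} (hA : BoldSigma β A)
    (hB : BoldSigma β B) : BoldSigma β (A ∪ B) := by
  cases hA with
  | of_isOpen _ hA =>
    cases hB with
    | of_isOpen _ hB => exact .of_isOpen _ (hA.union hB)
    -- The union form forces `1 < β`, so it cannot occur together with the open form.
    | iUnion _ B γ h => exact absurd (h 0).2 (h 0).1.not_gt
  | iUnion _ A γ h hA =>
    cases hB with
    | of_isOpen _ hB => exact absurd (h 0).2 (h 0).1.not_gt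
    | iUnion _ B δ h' hB =>
      have key : ∀ s : ℕ ⊕ ℕ, (1 ≤ Sum.elim γ δ s ∧ Sum.elim γ δ s < β) ∧
          BoldSigma (Sum.elim γ δ s) (Sum.elim A B s)ᶜ := by
        rintro (n | n)
        · exact ⟨h n, hA n⟩
        · exact ⟨h' n, hB n⟩
      have := BoldSigma.iUnion β (fun n => Sum.elim A B (Equiv.natSumNatEquivNat.symm n))
        (fun n => Sum.elim γ δ (Equiv.natSumNatEquivNat.symm n))
        (fun n => (key _).1) (fun n => (key _).2)
      rwa [Equiv.natSumNatEquivNat.symm.surjective.iUnion_comp (Sum.elim A B),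
        Set.iUnion_sum] at this

theorem BoldSigma.iUnion_compl {β : Ordinal.{0}} {A : ℕ → Set X}
    (hA : ∀ n, ∃ γ < β, BoldSigma γ (A n)ᶜ) : BoldSigma β (⋃ n, A n) := by
  choose γ hγ hA using hA
  exact .iUnion β A γ (fun n => ⟨(hA n).one_le, hγ n⟩) hA

theorem BoldDelta.compl {β : Ordinal.{0}} {A : Set X} (h : BoldDelta β A) : BoldDelta β Aᶜ :=
  ⟨h.2, by rw [compl_compl]; exact h.1⟩

variable [PerfectlyNormalSpace X]

/-- The only step with content is from open sets upwards: in a perfectly normal space they are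
countable unions of closed sets. -/
theorem BoldSigma.mono {β γ : Ordinal.{0}} {A : Set X} (h : BoldSigma γ A) (hγ : γ ≤ β) :
    BoldSigma β A := by
  rcases hγ.eq_or_lt with rfl | hlt
  · exact h
  cases h with
  | of_isOpen _ hA =>
    obtain ⟨f, hf, hf'⟩ := (isGδ_iff_eq_iInter_nat).1 (isClosed_compl_iff.2 hA).isGδ
    have hA' : A = ⋃ n, (f n)ᶜ := by rw [← Set.compl_iInter, ← hf', compl_compl]
    rw [hA']
    exact .iUnion β _ (fun _ => 1) (fun _ => ⟨le_rfl, hlt⟩)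
      (fun n => by rw [compl_compl]; exact .of_isOpen _ (hf n))
  | iUnion _ A δ h hA => exact .iUnion β A δ (fun n => ⟨(h n).1, (h n).2.trans hlt⟩) hA

theorem BoldSigma.inter {β : Ordinal.{0}} {A B : Set X} (hA : BoldSigma β A)
    (hB : BoldSigma β B) : BoldSigma β (A ∩ B) := by
  cases hA with
  | of_isOpen _ hA =>
    cases hB with
    | of_isOpen _ hB => exact .of_isOpen _ (hA.inter hB)
    | iUnion _ B γ h => exact absurd (h 0).2 (h 0).1.not_gt
  | iUnion _ A γ h hA =>
    cases hB with
    | of_isOpen _ hB => exact absurd (h 0).2 (h 0).1.not_gt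
    | iUnion _ B δ h' hB =>
      have hAB : (⋃ n, A n) ∩ ⋃ n, B n =
          ⋃ n, A (Nat.pairEquiv.symm n).1 ∩ B (Nat.pairEquiv.symm n).2 := by
        rw [Nat.pairEquiv.symm.surjective.iUnion_comp (fun p : ℕ × ℕ => A p.1 ∩ B p.2),
          Set.iUnion_prod', Set.iUnion_inter_iUnion]
      rw [hAB]
      refine BoldSigma.iUnion_compl fun n => ?_
      refine ⟨max (γ (Nat.pairEquiv.symm n).1) (δ (Nat.pairEquiv.symm n).2),
        max_lt (h _).2 (h' _).2, ?_⟩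
      rw [Set.compl_inter]
      exact ((hA _).mono (le_max_left _ _)).union ((hB _).mono (le_max_right _ _))

theorem BoldSigma.boldDelta {β γ : Ordinal.{0}} {A : Set X} (h : BoldSigma γ A) (hγ : γ < β) :
    BoldDelta β A :=
  ⟨h.mono hγ.le, h.compl_of_lt hγ⟩

variable (X) in
/-- The Boolean algebra of the `Δ⁰_β` sets. -/
def boldDeltaAlgebra (β : Ordinal.{0}) (hβ : 1 ≤ β) : BooleanSubalgebra (Set X) where
  carrier := {A | BoldDelta β A}
  supClosed' A hA B hB := ⟨hA.1.union hB.1, by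
    have := hA.2.inter hB.2; rwa [← Set.compl_union] at this⟩
  infClosed' A hA B hB := ⟨hA.1.inter hB.1, by
    have := hA.2.union hB.2; rwa [← Set.compl_inter] at this⟩
  compl_mem' hA := hA.compl
  bot_mem' := ⟨(BoldSigma.of_isOpen _ isOpen_empty).mono hβ,
    (BoldSigma.of_isOpen _ (by simp)).mono hβ⟩

end BoldSigma

/-! ### Sets depending on finitely many coordinates, and the diagonal point. -/

section Cylinders

variable {ι : Type*} (e : ι → ℕ)

/-- The Boolean algebra of the sets which depend only on the coordinates `i` with `e i < n`. -/
def cylinderAlgebra (n : ℕ) : BooleanSubalgebra (Set (ι → Bool)) where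
  carrier := {A | ∀ x y : ι → Bool, (∀ i, e i < n → x i = y i) → (x ∈ A ↔ y ∈ A)}
  supClosed' _ hA _ hB x y h := or_congr (hA x y h) (hB x y h)
  infClosed' _ hA _ hB x y h := and_congr (hA x y h) (hB x y h)
  compl_mem' hA x y h := not_congr (hA x y h)
  bot_mem' _ _ _ := Iff.rfl

variable {e}

theorem cylinderAlgebra_mono {m n : ℕ} (h : m ≤ n) :
    cylinderAlgebra e m ≤ cylinderAlgebra e n :=
  fun _ hA x y hxy => hA x y fun i hi => hxy i (hi.trans_le h)

theorem isOpen_of_mem_cylinderAlgebra (he : Function.Injective e) {n : ℕ} {A : Set (ι → Bool)}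
    (hA : A ∈ cylinderAlgebra e n) : IsOpen A := by
  rw [isOpen_iff_mem_nhds]
  intro x hx
  have hfin : {i | e i < n}.Finite := (Set.finite_Iio n).preimage he.injOn
  refine mem_of_superset (set_pi_mem_nhds hfin (s := fun i => {x i})
    fun i _ => (isOpen_discrete _).mem_nhds rfl) fun y hy => ?_
  exact (hA x y fun i hi => (hy i hi).symm).1 hx

variable (e) in
/-- The points which agree below `n` with some point of `W`. -/
def cylinderHull (W : Set (ι → Bool)) (n : ℕ) : Set (ι → Bool) :=
  {x | ∃ y ∈ W, ∀ i, e i < n → x i = y i}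

theorem cylinderHull_mem (W : Set (ι → Bool)) (n : ℕ) :
    cylinderHull e W n ∈ cylinderAlgebra e n := by
  intro x y h
  constructor
  · rintro ⟨z, hz, hxz⟩
    exact ⟨z, hz, fun i hi => (h i hi).symm.trans (hxz i hi)⟩
  · rintro ⟨z, hz, hyz⟩
    exact ⟨z, hz, fun i hi => (h i hi).trans (hyz i hi)⟩

/-- A point outside a closed set has a basic neighbourhood missing it, which restricts only finitely
many coordinates, all with code below some `n`. -/
theorem iInter_cylinderHull {W : Set (ι → Bool)} (hW : IsClosed W) :
    ⋂ n, cylinderHull e W n = W := by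
  refine Set.Subset.antisymm (fun x hx => ?_)
    (Set.subset_iInter fun n x hx => ⟨x, hx, fun _ _ => rfl⟩)
  by_contra hxW
  obtain ⟨s, u, hu, hsu⟩ := isOpen_pi_iff.1 hW.isOpen_compl x hxW
  obtain ⟨y, hy, hxy⟩ := Set.mem_iInter.1 hx (s.sup e + 1)
  refine hsu (fun i hi => ?_) hy
  rw [← hxy i (Nat.lt_succ_of_le (Finset.le_sup (f := e) hi))]
  exact (hu i hi).2

/-- A point whose coordinates are prescribed by sets each of which depends only on earlier
coordinates. -/
theorem exists_fixedPoint {P : ι → Set (ι → Bool)} (hP : ∀ i, P i ∈ cylinderAlgebra e (e i)) :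
    ∃ x : ι → Bool, ∀ i, x i = true ↔ x ∈ P i := by
  classical
  let wf : WellFounded (InvImage (· < ·) e) := InvImage.wf e wellFounded_lt
  let F (i : ι) (ih : ∀ j, e j < e i → Bool) : Bool :=
    decide ((fun j => if h : e j < e i then ih j h else false) ∈ P i)
  let x : ι → Bool := wf.fix F
  refine ⟨x, fun i => ?_⟩
  have hx : x i = F i fun j _ => x j := wf.fix_eq F i
  rw [hx, decide_eq_true_iff]
  refine hP i _ _ fun j hj => ?_
  simp [hj]

/-! ### Borel sets as pointwise limits of sets of lower class. -/

variable [Countable ι]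

variable (e) in
open Classical in
/-- The sets allowed at the `k`-th child when this child has rank `ρ`: the sets depending on the
coordinates below `k` if `ρ = 0`, and the `Δ⁰_{ρ+1}` sets otherwise. -/
noncomputable def levelAlgebra (ρ : Ordinal.{0}) (k : ℕ) : BooleanSubalgebra (Set (ι → Bool)) :=
  if ρ = 0 then cylinderAlgebra e k else boldDeltaAlgebra (ι → Bool) (ρ + 1) le_add_self

theorem levelAlgebra_zero (k : ℕ) : levelAlgebra e 0 k = cylinderAlgebra e k := if_pos rfl

theorem mem_levelAlgebra {ρ : Ordinal.{0}} (hρ : ρ ≠ 0) {k : ℕ} {A : Set (ι → Bool)} :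
    A ∈ levelAlgebra e ρ k ↔ BoldDelta (ρ + 1) A := by
  rw [levelAlgebra, if_neg hρ]; rfl

theorem levelAlgebra_mono {ρ : Ordinal.{0}} {m n : ℕ} (h : m ≤ n) :
    levelAlgebra e ρ m ≤ levelAlgebra e ρ n := by
  rcases eq_or_ne ρ 0 with rfl | hρ
  · simpa only [levelAlgebra_zero] using cylinderAlgebra_mono h
  · exact fun A hA => (mem_levelAlgebra hρ).2 ((mem_levelAlgebra hρ).1 hA)

theorem cylinderAlgebra_le_levelAlgebra (he : Function.Injective e) (ρ : Ordinal.{0}) (k : ℕ) :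
    cylinderAlgebra e k ≤ levelAlgebra e ρ k := by
  rcases eq_or_ne ρ 0 with rfl | hρ
  · rw [levelAlgebra_zero]
  · intro A hA
    refine (mem_levelAlgebra hρ).2 ⟨?_, ?_⟩
    · exact (BoldSigma.of_isOpen _ (isOpen_of_mem_cylinderAlgebra he hA)).mono le_add_self
    · exact (BoldSigma.of_isOpen _ (isOpen_of_mem_cylinderAlgebra he
        (BooleanSubalgebra.compl_mem hA))).mono le_add_self

theorem BoldSigma.mem_levelAlgebra {ρ γ : Ordinal.{0}} {A : Set (ι → Bool)}
    (hA : BoldSigma γ A) (hγ : γ ≤ ρ) (k : ℕ) : A ∈ levelAlgebra e ρ k := by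
  have hρ : ρ ≠ 0 := (zero_lt_one.trans_le (hA.one_le.trans hγ)).ne'
  exact (IteratedFrechet.mem_levelAlgebra hρ).2
    (hA.boldDelta (hγ.trans_lt (Order.lt_add_one_iff.2 le_rfl)))

/-- A set whose complement is `Σ⁰_β` is approximated from above by sets of the levels
below `β`. -/
theorem exists_approx_of_boldSigma_compl (he : Function.Injective e) {β γ : Ordinal.{0}}
    {ρ : ℕ → Ordinal.{0}} (hρ : ∀ γ < β, ∀ᶠ k in atTop, γ ≤ ρ k) {W : Set (ι → Bool)}
    (hW : BoldSigma γ Wᶜ) (hγ : γ ≤ β) :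
    ∃ R : ℕ → Set (ι → Bool), (∀ k, R k ∈ levelAlgebra e (ρ k) k) ∧ (∀ k, W ⊆ R k) ∧
      ∀ x ∉ W, ∀ᶠ k in atTop, x ∉ R k := by
  obtain ⟨T, hT, hTW⟩ : ∃ T : ℕ → Set (ι → Bool),
      (∀ n, ∀ᶠ k in atTop, T n ∈ levelAlgebra e (ρ k) k) ∧ ⋂ n, T n = W := by
    generalize hV : Wᶜ = V at hW
    cases hW with
    | of_isOpen _ hV' =>
      subst hV
      refine ⟨cylinderHull e W, fun n => ?_, iInter_cylinderHull (isOpen_compl_iff.1 hV')⟩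
      filter_upwards [eventually_ge_atTop n] with k hk
      exact cylinderAlgebra_le_levelAlgebra he _ _
        (cylinderAlgebra_mono hk (cylinderHull_mem W n))
    | iUnion _ B δ h hB =>
      refine ⟨fun n => (B n)ᶜ, fun n => ?_, by rw [← Set.compl_iUnion, ← hV, compl_compl]⟩
      filter_upwards [hρ (δ n) ((h n).2.trans_le hγ)] with k hk
      exact (hB n).mem_levelAlgebra hk k
  have hsub (k : ℕ) : {n | n ≤ k ∧ T n ∈ levelAlgebra e (ρ k) k}.Finite :=
    (Set.finite_Iic k).subset fun n hn => hn.1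
  -- At stage `k`, intersect those `T n` with `n ≤ k` that already belong to the level. The
  -- intersection is finite, and each `T n` eventually takes part.
  refine ⟨fun k => ⋂ n ∈ {n | n ≤ k ∧ T n ∈ levelAlgebra e (ρ k) k}, T n, fun k => ?_,
    fun k => ?_, fun x hx => ?_⟩
  · exact BooleanSubalgebra.biInf_mem (hsub k) fun n hn => hn.2
  · exact hTW ▸ Set.subset_iInter₂ fun n _ => Set.iInter_subset T n
  · rw [← hTW, Set.mem_iInter, not_forall] at hx
    obtain ⟨n, hn⟩ := hx
    filter_upwards [hT n, eventually_ge_atTop n] with k hk hnk hxk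
    exact hn (Set.mem_iInter₂.1 hxk n ⟨hnk, hk⟩)

/-- Every `Δ⁰_{β+1}` set is a pointwise limit of sets of the levels below `β`. -/
theorem exists_limit_of_boldDelta (he : Function.Injective e) {β : Ordinal.{0}} (hβ : β ≠ 0)
    {ρ : ℕ → Ordinal.{0}} (hρ : ∀ γ < β, ∀ᶠ k in atTop, γ ≤ ρ k) {A : Set (ι → Bool)}
    (hA : BoldDelta (β + 1) A) :
    ∃ B : ℕ → Set (ι → Bool), (∀ k, B k ∈ levelAlgebra e (ρ k) k) ∧
      (∀ x ∈ A, ∀ᶠ k in atTop, x ∈ B k) ∧ ∀ x ∉ A, ∀ᶠ k in atTop, x ∉ B k := by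
  have hunion : ∀ A : Set (ι → Bool), BoldSigma (β + 1) A →
      ∃ P : ℕ → Set (ι → Bool), A = ⋃ n, P n ∧ ∃ R : ℕ → ℕ → Set (ι → Bool),
        ∀ n, (∀ k, R n k ∈ levelAlgebra e (ρ k) k) ∧ (∀ k, P n ⊆ R n k) ∧
          ∀ x ∉ P n, ∀ᶠ k in atTop, x ∉ R n k := by
    intro A hA
    generalize hβ' : β + 1 = β' at hA
    cases hA with
    | of_isOpen =>
      have := Order.lt_add_one_iff.2 (Order.one_le_iff_pos.2 (pos_iff_ne_zero.2 hβ))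
      exact absurd hβ' this.ne'
    | iUnion _ P γ h hP =>
      subst hβ'
      have := fun n => exists_approx_of_boldSigma_compl he hρ (hP n)
        (Order.lt_add_one_iff.1 (h n).2)
      choose R hR using this
      exact ⟨P, rfl, R, hR⟩
  obtain ⟨P, hAP, R, hR⟩ := hunion A hA.1
  obtain ⟨Q, hAQ, S, hS⟩ := hunion Aᶜ hA.2
  -- A race between the pieces `P i` of `A` and `Q j` of `Aᶜ`: accept `x` at stage `k` if some `R i
  -- k` contains it and no `S j k` with `j < i` does. A true piece is never dropped by its
  -- approximations, and its finitely many rivals of smaller index eventually are.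
  refine ⟨fun k => ⋃ i ∈ Set.Iic k, R i k ∩ ⋂ j ∈ Set.Iio i, (S j k)ᶜ, fun k => ?_,
    fun x hx => ?_, fun x hx => ?_⟩
  · refine BooleanSubalgebra.biSup_mem (Set.finite_Iic k) fun i _ => ?_
    exact BooleanSubalgebra.inf_mem ((hR i).1 k) (BooleanSubalgebra.biInf_mem (Set.finite_Iio i)
      fun j _ => BooleanSubalgebra.compl_mem ((hS j).1 k))
  · obtain ⟨i, hi⟩ := Set.mem_iUnion.1 (hAP ▸ hx)
    have hQ : ∀ j, x ∉ Q j := fun j hj => by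
      have : x ∈ Aᶜ := hAQ ▸ Set.mem_iUnion_of_mem j hj
      exact this hx
    filter_upwards [eventually_ge_atTop i, (Set.finite_Iio i).eventually_all.2
      fun j _ => (hS j).2.2 x (hQ j)] with k hik hk
    exact Set.mem_biUnion (Set.mem_Iic.2 hik) ⟨(hR i).2.1 k hi, Set.mem_iInter₂.2 hk⟩
  · obtain ⟨j, hj⟩ := Set.mem_iUnion.1 (hAQ ▸ (show x ∈ Aᶜ from hx))
    have hP : ∀ i, x ∉ P i := fun i hi => hx (hAP ▸ Set.mem_iUnion_of_mem i hi)
    filter_upwards [(Set.finite_Iic j).eventually_all.2 fun i _ => (hR i).2.2 x (hP i)]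
      with k hk hxk
    obtain ⟨i, -, hi, hi'⟩ := Set.mem_iUnion₂.1 hxk
    rcases le_or_gt i j with hij | hij
    · exact hk i hij hi
    · exact Set.mem_iInter₂.1 hi' j hij ((hS j).2.1 k hj)

end Cylinders

/-! ### Spreading a set over the tree. -/

/-- Makes a bound by the child index `k` a bound by the code of `σ⌢k`, as the fixed point requires.
-/
theorem le_encode_of_mem {k : ℕ} : ∀ {σ : List ℕ}, k ∈ σ → k ≤ Encodable.encode σ
  | a :: σ, h => by
    rw [Encodable.encode_list_cons]
    rcases List.mem_cons.1 h with rfl | h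
    · exact (Nat.left_le_pair _ _).trans (Nat.le_succ _)
    · exact ((le_encode_of_mem h).trans (Nat.right_le_pair _ _)).trans (Nat.le_succ _)

namespace CofinalSequences

variable {α : Ordinal.{0}} (c : CofinalSequences α)

/-- The numbering of the leaves. -/
def leafCode (l : c.leaves) : ℕ := Encodable.encode l.1

theorem leafCode_injective : Function.Injective c.leafCode :=
  Encodable.encode_injective.comp Subtype.val_injective

/-- The ranks of the children of a node of rank `β ≠ 0` eventually exceed every `γ < β`. -/
theorem exists_childRank {σ : List ℕ} {β : Ordinal.{0}} (hσ : c.HasRank σ β) (hβ : β ≠ 0) :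
    ∃ ρ : ℕ → Ordinal.{0}, (∀ k, c.HasRank (σ ++ [k]) (ρ k)) ∧
      ∀ γ < β, ∀ᶠ k in atTop, γ ≤ ρ k := by
  rcases Ordinal.zero_or_succ_or_isSuccLimit β with rfl | ⟨δ, rfl⟩ | hlim
  · exact absurd rfl hβ
  · exact ⟨fun _ => δ, fun k => .succ σ δ k hσ,
      fun γ hγ => Eventually.of_forall fun _ => Order.lt_succ_iff.1 hγ⟩
  · refine ⟨c.seq β, fun k => .limit σ β k hlim hσ, fun γ hγ => ?_⟩
    obtain ⟨n, hn⟩ := c.cofinal β hσ.le hlim γ hγ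
    filter_upwards [eventually_ge_atTop n] with k hk
    exact hn.trans ((c.strictMono β hσ.le hlim).monotone hk)

/-- The rank is quantified after `B`, so that `B` can be chosen as a function of `σ` and `A` alone
and iterated along lists. -/
theorem exists_childSets (σ : List ℕ) (A : Set c.Space) :
    ∃ B : ℕ → Set c.Space, ∀ β ≠ 0, c.HasRank σ β → BoldDelta (β + 1) A →
      (∀ k γ, c.HasRank (σ ++ [k]) γ → B k ∈ levelAlgebra c.leafCode γ k) ∧
      (∀ x ∈ A, ∀ᶠ k in atTop, x ∈ B k) ∧ ∀ x ∉ A, ∀ᶠ k in atTop, x ∉ B k := by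
  by_cases h : ∃ β ≠ 0, c.HasRank σ β ∧ BoldDelta (β + 1) A
  · obtain ⟨β, hβ, hσ, hA⟩ := h
    obtain ⟨ρ, hρ, hρ'⟩ := c.exists_childRank hσ hβ
    obtain ⟨B, hB, hB'⟩ := exists_limit_of_boldDelta c.leafCode_injective hβ hρ' hA
    exact ⟨B, fun _ _ _ _ => ⟨fun k γ hγ => hγ.unique (hρ k) ▸ hB k, hB'⟩⟩
  · exact ⟨fun _ => ∅, fun β hβ hσ hA => absurd ⟨β, hβ, hσ, hA⟩ h⟩

/-- A `Δ⁰_{α+1}` set is spread over the tree `T_α` so that the set at a node is the limit of the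
sets at its children, and the set at a leaf depends only on the preceding leaves. -/
theorem exists_nodeSets (hα : α ≠ 0) {A : Set c.Space} (hA : BoldDelta (α + 1) A) :
    ∃ s : List ℕ → Set c.Space, s [] = A ∧
      (∀ l : c.leaves, s l.1 ∈ cylinderAlgebra c.leafCode (c.leafCode l)) ∧
      ∀ σ ∈ c.tree, σ ∉ c.leaves → (∀ x ∈ s σ, ∀ᶠ k in atTop, x ∈ s (σ ++ [k])) ∧
        ∀ x ∉ s σ, ∀ᶠ k in atTop, x ∉ s (σ ++ [k]) := by
  choose B hB using c.exists_childSets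
  let s (σ : List ℕ) : Set c.Space := List.reverseRecOn σ A fun σ k S => B σ S k
  have hnil : s [] = A := List.reverseRecOn_nil ..
  have hs (σ : List ℕ) (k : ℕ) : s (σ ++ [k]) = B σ (s σ) k := List.reverseRecOn_concat ..
  have hchild {σ : List ℕ} {β γ : Ordinal.{0}} {k : ℕ} (hσ : c.HasRank σ β) (hβ : β ≠ 0)
      (hγ : c.HasRank (σ ++ [k]) γ)
      (ih : s σ ∈ levelAlgebra c.leafCode β (Encodable.encode σ)) :
      s (σ ++ [k]) ∈ levelAlgebra c.leafCode γ (Encodable.encode (σ ++ [k])) := by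
    rw [hs]
    exact levelAlgebra_mono (le_encode_of_mem (by simp))
      ((hB σ (s σ) β hβ hσ ((mem_levelAlgebra hβ).1 ih)).1 k γ hγ)
  have hlevel {σ : List ℕ} {β : Ordinal.{0}} (hσ : c.HasRank σ β) :
      s σ ∈ levelAlgebra c.leafCode β (Encodable.encode σ) := by
    induction hσ with
    -- Since `α ≠ 0`, the level at the root does not depend on the index, here the code of `[]`.
    | root => rw [hnil]; exact (mem_levelAlgebra hα).2 hA
    | succ σ β k hσ ih => exact hchild hσ (Order.succ_ne_bot β) (.succ σ β k hσ) ih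
    | limit σ δ k hδ hσ ih => exact hchild hσ hδ.ne_bot (.limit σ δ k hδ hσ) ih
  refine ⟨s, hnil, fun l => ?_, fun σ hσ hl => ?_⟩
  · have := hlevel l.2
    rwa [levelAlgebra_zero] at this
  · obtain ⟨β, hσ⟩ := hσ
    have hβ : β ≠ 0 := by rintro rfl; exact hl hσ
    simp only [hs]
    exact (hB σ (s σ) β hβ hσ ((mem_levelAlgebra hβ).1 (hlevel hσ))).2

/-- Well-founded induction from the leaves: membership that holds at almost all children is exactly
what both labellings propagate. -/
theorem labels_of_nodeSets {s : List ℕ → Set c.Space} {x : c.Space}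
    (hx : ∀ l : c.leaves, x l = true ↔ x ∈ s l.1)
    (hs : ∀ σ ∈ c.tree, σ ∉ c.leaves → (∀ x ∈ s σ, ∀ᶠ k in atTop, x ∈ s (σ ++ [k])) ∧
      ∀ x ∉ s σ, ∀ᶠ k in atTop, x ∉ s (σ ++ [k])) (σ : c.tree) :
    (x ∈ s σ.1 → c.filterLabel x σ = true) ∧ (x ∉ s σ.1 → c.idealLabel x σ = false) := by
  induction σ using c.child_wellFounded.induction with
  | _ σ ih =>
    by_cases hl : σ.1 ∈ c.leaves
    · rw [c.filterLabel_leaf x σ hl, c.idealLabel_leaf x σ hl, ← hx ⟨σ.1, hl⟩]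
      simp
    · rw [c.filterLabel_node x σ hl, c.idealLabel_node x σ hl]
      have ih' (k : ℕ) := ih (c.child σ hl k) ⟨k, rfl⟩
      have hlim := hs σ.1 σ.2 hl
      constructor
      · intro h
        have := (hlim.1 x h).mono fun k hk => (ih' k).1 hk
        rwa [← Nat.cofinite_eq_atTop] at this
      · intro h
        have := (hlim.2 x h).mono fun k hk => (ih' k).2 hk
        rwa [← Nat.cofinite_eq_atTop] at this

end CofinalSequences

end IteratedFrechet

theorem mainTheorem8 (α : Ordinal.{0}) (hα : 1 ≤ α) (hα' : α < ω₁)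
    (c : IteratedFrechet.CofinalSequences α) :
    ¬ ∃ Z : Set c.Space, IteratedFrechet.BoldDelta (α + 1) Z ∧
      IteratedFrechet.Separates Z c.frechetFilter c.frechetIdeal := by
  rintro ⟨Z, hZ, hF, hI⟩
  -- Starting from the complement makes the diagonal point contradict `Z`.
  obtain ⟨s, hroot, hleaf, hlim⟩ := c.exists_nodeSets (zero_lt_one.trans_le hα).ne' hZ.compl
  obtain ⟨x, hx⟩ := IteratedFrechet.exists_fixedPoint hleaf
  have hlabel := c.labels_of_nodeSets hx hlim c.root
  rw [show s c.root.1 = Zᶜ from hroot] at hlabel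
  by_cases hxZ : x ∈ Z
  · exact hI (hlabel.2 (not_not_intro hxZ)) hxZ
  · exact hxZ (hF (hlabel.1 hxZ))
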